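/- All graphs are finite and simple. A hypergraph $\mathcal H=(V,\mathcal E)$ (without repeated hyperedges) contains a Berge-$F$, for a graph $F=(U,E)$, if there are injections $\psi:U\to V$ and $\varphi:E\to\mathcal E$ such that $\{\psi(u),\psi(v)\}\subset\varphi(e)$ for every edge $e=\{u,v\}\in E$. Let $\mathrm{ex}_r(n,F)$ be the maximum number of hyperedges of an $r$-uniform hypergraph on $n$ vertices that contains no Berge-$F$, and let $$\mathrm{thres}(F)=\min\{r_0\ge 2 : \mathrm{ex}_r(n,F)=o(n^2)\text{ as } n\to\infty \text{ for all } r\ge r_0\}.$$ For graphs $G,H$ let $R(G,H)$ be the least $n$ such that every $2$-coloring of the edges of the complete graph $K_n$ contains a copy of $G$ in the first color or a copy of $H$ in the second color. For an edge $e$ of $F$, let $F\setminus e$ be the graph obtained from $F$ by deleting the edge $e$ and keeping all vertices. Theorem. Let $F$ be a graph with at least two edges and let $e$ be any edge of $F$. Then $\mathrm{thres}(F)\le R(F,F\setminus e)$. Moreover, for every $r\ge R(F,F\setminus e)$ and every $\varepsilon>0$ there is an $N$ such that for all $n\ge N$ every $r$-uniform hypergraph on $n$ vertices that contains no Berge-$F$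 has at most $\varepsilon n^2$ hyperedges. -/

import Mathlib

open Asymptotics Filter

/-- A hypergraph `H` contains a Berge-`F`: there are injections `ψ` from the vertices of `F` to the
vertices of `H` and `φ` from the edges of `F` to the hyperedges of `H` such that both endpoints of
every edge `e` of `F` are mapped by `ψ` into the hyperedge `φ e`. -/
def Hypergraph.ContainsBerge {U α : Type*} (H : Hypergraph α) (F : SimpleGraph U) : Prop :=
  ∃ (ψ : U ↪ H.vertexSet) (φ : F.edgeSet ↪ H.edgeSet),
    ∀ e : F.edgeSet, ∀ u ∈ (e : Sym2 U), (ψ u : α) ∈ (φ e : Set α)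

/-- A hypergraph is `r`-uniform if every hyperedge has exactly `r` elements. -/
def Hypergraph.IsUniform {α : Type*} (H : Hypergraph α) (r : ℕ) : Prop :=
  ∀ h ∈ H.edgeSet, h.encard = r

/-- `bergeEx r n F` is the maximum number of hyperedges of an `r`-uniform hypergraph on `n` vertices
that contains no Berge-`F`. (The set is bounded, since there are finitely many hypergraphs on
`Fin n`; it contains `0` whenever `F` has an edge.) -/
noncomputable def bergeEx {U : Type*} (r n : ℕ) (F : SimpleGraph U) : ℕ :=
  sSup {m | ∃ H : Hypergraph (Fin n), H.vertexSet = Set.univ ∧ H.IsUniform r ∧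
    ¬ H.ContainsBerge F ∧ H.edgeSet.ncard = m}

/-- The uniformity threshold of `F`: the least `r₀ ≥ 2` such that, for all `r ≥ r₀`, the function
`n ↦ bergeEx r n F` is `o(n ^ 2)`. -/
noncomputable def uniformityThreshold {U : Type*} (F : SimpleGraph U) : ℕ :=
  sInf {r₀ | 2 ≤ r₀ ∧ ∀ r ≥ r₀,
    (fun n : ℕ => (bergeEx r n F : ℝ)) =o[atTop] (fun n : ℕ => (n : ℝ) ^ 2)}

/-- The Ramsey number of `G` and `H`: the least `n` such that every 2-colouring of the edges of the
complete graph on `n` vertices contains a copy of `G` in the first colour or of `H` in the second.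
A 2-colouring is given by the graph `A` of the edges of the first colour; the edges of the second
colour then form the complement `Aᶜ`. -/
noncomputable def ramseyNumber {U W : Type*} (G : SimpleGraph U) (H : SimpleGraph W) : ℕ :=
  sInf {n | ∀ A : SimpleGraph (Fin n), G.IsContained A ∨ H.IsContained Aᶜ}

/-! ### Finiteness of two-colour Ramsey numbers. -/

section Ramsey

/-! Let k be the number of edges of F, and call a pair light if it lies in at least one but fewer
than k hyperedges. Inside a hyperedge h every pair is light or lies in at least k hyperedges
(heavy). As h has at least R(F, F∖e) vertices, it contains a light F or a heavy F∖e. In the latter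
case Hall's theorem, with h available for e, yields a Berge-F (`containsBerge_of_heavy`). So in a
Berge-F-free hypergraph every hyperedge contains a light copy of F (`exists_light_copy`).

By the removal lemma (`exists_removal`), either εn²/k pairs meet every homomorphism from F to the
light graph, or there are at least βn^|U| homomorphisms. In the first case every hyperedge contains
a light one of these pairs, each such pair lies in fewer than k hyperedges, and the bound εn²
follows. In the second case, all but O(n^(|U|-1)) homomorphisms are injective and put no further
vertex into a hyperedge through a light pair of image vertices. For such a homomorphism, distinct
edges of F necessarily get distinct hyperedges, which is a Berge-F. -/

open Finset in
/-- Finite Ramsey theorem for two colours. -/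
theorem SimpleGraph.exists_isNClique_or_isNClique_compl (s t : ℕ) :
    ∃ N : ℕ, ∀ (V : Type) [DecidableEq V] (A : SimpleGraph V) (W : Finset V), N ≤ #W →
      ∃ K ⊆ W, A.IsNClique s K ∨ Aᶜ.IsNClique t K := by
  induction s generalizing t with
  | zero => exact ⟨0, fun V _ A W _ => ⟨∅, by simp, Or.inl (by simp)⟩⟩
  | succ s ihs =>
    induction t with
    | zero => exact ⟨0, fun V _ A W _ => ⟨∅, by simp, Or.inr (by simp)⟩⟩
    | succ t iht =>
      obtain ⟨N₁, h₁⟩ := ihs (t + 1)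
      obtain ⟨N₂, h₂⟩ := iht
      refine ⟨N₁ + N₂ + 1, fun V _ A W hW => ?_⟩
      classical
      obtain ⟨x, hx⟩ : W.Nonempty := by
        rw [← Finset.card_pos]; omega
      -- At least N₁ + N₂ vertices remain besides x, so x has N₁ neighbours or N₂ non-neighbours
      -- among them.
      have hcard : #{y ∈ W.erase x | A.Adj x y} + #{y ∈ W.erase x | ¬ A.Adj x y} = #W - 1 := by
        rw [Finset.card_filter_add_card_filter_not, Finset.card_erase_of_mem hx]
      by_cases h : N₁ ≤ #{y ∈ W.erase x | A.Adj x y}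
      · obtain ⟨K, hK, hc | hc⟩ := h₁ V A _ h
        · refine ⟨insert x K, ?_, Or.inl (hc.insert fun b hb => ?_)⟩
          · exact Finset.insert_subset hx (hK.trans ((filter_subset _ _).trans (erase_subset _ _)))
          · exact (Finset.mem_filter.1 (hK hb)).2
        · exact ⟨K, hK.trans ((filter_subset _ _).trans (erase_subset _ _)), Or.inr hc⟩
      · obtain ⟨K, hK, hc | hc⟩ := h₂ V A {y ∈ W.erase x | ¬ A.Adj x y} (by omega)
        · exact ⟨K, hK.trans ((filter_subset _ _).trans (erase_subset _ _)), Or.inl hc⟩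
        · refine ⟨insert x K, ?_, Or.inr (hc.insert fun b hb => ?_)⟩
          · exact Finset.insert_subset hx (hK.trans ((filter_subset _ _).trans (erase_subset _ _)))
          · have := Finset.mem_filter.1 (hK hb)
            exact ⟨(Finset.ne_of_mem_erase this.1).symm, this.2⟩

theorem SimpleGraph.IsNClique.isContained {U V : Type*} [Finite U] {A : SimpleGraph V}
    {K : Finset V} (hK : A.IsNClique (Nat.card U) K) (G : SimpleGraph U) : G.IsContained A := by
  have e : U ≃ K := (Finite.equivFin U).trans (K.equivFinOfCardEq hK.card_eq).symm
  refine ⟨⟨⟨fun u => e u, fun {a b} hab => ?_⟩, fun a b hab => e.injective (Subtype.ext hab)⟩⟩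
  exact hK.isClique (e a).2 (e b).2 fun h => hab.ne (e.injective (Subtype.ext h))

/-- Since `sInf ∅ = 0`, the infimum is attained only because Ramsey's theorem makes the set
nonempty. -/
theorem ramseyNumber_spec {U W : Type*} [Finite U] [Finite W] (G : SimpleGraph U)
    (H : SimpleGraph W) (A : SimpleGraph (Fin (ramseyNumber G H))) :
    G.IsContained A ∨ H.IsContained Aᶜ := by
  have hne : {n | ∀ A : SimpleGraph (Fin n), G.IsContained A ∨ H.IsContained Aᶜ}.Nonempty := by
    obtain ⟨N, hN⟩ := SimpleGraph.exists_isNClique_or_isNClique_compl (Nat.card U) (Nat.card W)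
    refine ⟨N, fun A => ?_⟩
    obtain ⟨K, -, h | h⟩ := hN (Fin N) A Finset.univ (by simp)
    · exact Or.inl (h.isContained G)
    · exact Or.inr (h.isContained H)
  exact Nat.sInf_mem hne A

end Ramsey

/-! ### Counting and removal lemmas for homomorphisms. -/

section Counting

open Finset

/-- The candidates in `C` for a neighbour of `x`: bad vertices are few in a uniform dense pair. -/
theorem SimpleGraph.IsUniform.card_filter_lt {V : Type*} [DecidableEq V] {G : SimpleGraph V}
    [DecidableRel G.Adj] {ε d : ℝ} {S T C D : Finset V} (hST : G.IsUniform ε S T)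
    (hε : 0 < ε) (hεd : ε ≤ d / 2) (hd : d ≤ G.edgeDensity S T) (hC : C ⊆ S) (hD : D ⊆ T)
    (hDT : #T * ε ≤ #D) (hS : S.Nonempty) :
    (#{x ∈ C | (#{y ∈ D | G.Adj x y} : ℝ) < d / 2 * #D} : ℝ) < #S * ε := by
  set B := {x ∈ C | (#{y ∈ D | G.Adj x y} : ℝ) < d / 2 * #D} with hB
  by_contra! hcon
  have hBS : B ⊆ S := (filter_subset _ _).trans hC
  -- Were the bad set this large, regularity would force its density to D above d - ε ≥ d/2, against
  -- its definition.
  have h := hST hBS hD hcon hDT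
  have hBpos : 0 < #B := by
    have : (0 : ℝ) < #S * ε := mul_pos (by exact_mod_cast hS.card_pos) hε
    exact_mod_cast this.trans_le hcon
  have hlow : d / 2 < G.edgeDensity B D := by
    have := (abs_lt.1 h).1
    linarith
  have hDpos : 0 < #D := by
    rcases Nat.eq_zero_or_pos #D with h0 | h0
    · obtain ⟨x, hx⟩ := card_pos.1 hBpos
      have := (mem_filter.1 hx).2
      simp [Finset.card_eq_zero.1 h0] at this
    · exact h0
  have hcnt : (#(G.interedges B D) : ℝ) ≤ #B * (d / 2 * #D) := by
    have : #(G.interedges B D) = ∑ x ∈ B, #{y ∈ D | G.Adj x y} := by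
      rw [SimpleGraph.interedges, Rel.interedges, card_filter, sum_product]
      simp_rw [card_filter]
    rw [this]
    push_cast
    rw [← nsmul_eq_mul]
    exact sum_le_card_nsmul _ _ _ fun x hx => (mem_filter.1 hx).2.le
  rw [SimpleGraph.edgeDensity_def] at hlow
  push_cast at hlow
  rw [lt_div_iff₀ (by positivity)] at hlow
  nlinarith

/-- **Counting lemma** for homomorphisms with prescribed candidate sets. -/
theorem SimpleGraph.exists_le_card_homs (m : ℕ) (d : ℝ) (hd : 0 < d) :
    ∀ α : ℝ, 0 < α → ∃ ε > 0, ∃ β > 0, ∀ δ : ℝ, 0 < δ → δ ≤ ε → ∀ (V : Type) [Fintype V]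
      [DecidableEq V] (G : SimpleGraph V) [DecidableRel G.Adj] (F : SimpleGraph (Fin m))
      [DecidableRel F.Adj] (P C : Fin m → Finset V), (∀ i, (P i).Nonempty) → (∀ i, C i ⊆ P i) →
      (∀ i, α * #(P i) ≤ #(C i)) →
      (∀ i j, F.Adj i j → G.IsUniform δ (P i) (P j) ∧ d ≤ G.edgeDensity (P i) (P j)) →
      β * ∏ i, (#(P i) : ℝ) ≤
        #{f : Fin m → V | (∀ i, f i ∈ C i) ∧ ∀ i j, F.Adj i j → G.Adj (f i) (f j)} := by
  induction m with
  | zero =>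
    intro α hα
    refine ⟨1, one_pos, 1, one_pos, fun δ _ _ V _ _ G _ F _ P C _ _ _ _ => ?_⟩
    simp
  | succ m ih =>
    intro α hα
    obtain ⟨ε₁, hε₁, β₁, hβ₁, H⟩ := ih (min α (d / 2 * α)) (by positivity)
    -- The last bound keeps the at most m bad sets below half of α|P 0| in total; the bound α makes
    -- the candidate sets large enough for regularity.
    refine ⟨min (min ε₁ (d / 2)) (min α (α / (2 * (m + 1)))), by positivity, α / 2 * β₁,
      by positivity, ?_⟩
    intro δ hδ hδle V _ _ G _ F _ P C hP hCP hαC hU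
    have hδ₁ : δ ≤ ε₁ := hδle.trans ((min_le_left _ _).trans (min_le_left _ _))
    have hδ₂ : δ ≤ d / 2 := hδle.trans ((min_le_left _ _).trans (min_le_right _ _))
    have hδ₃ : δ ≤ α := hδle.trans ((min_le_right _ _).trans (min_le_left _ _))
    have hδ₄ : δ ≤ α / (2 * (m + 1)) := hδle.trans ((min_le_right _ _).trans (min_le_right _ _))
    let bad : Fin m → Finset V := fun j =>
      {x ∈ C 0 | (#{y ∈ C j.succ | G.Adj x y} : ℝ) < d / 2 * #(C j.succ)}
    let good : Finset V := {x ∈ C 0 | ∀ j : Fin m, F.Adj 0 j.succ → x ∉ bad j}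
    have hbad : ∀ j : Fin m, F.Adj 0 j.succ → (#(bad j) : ℝ) ≤ #(P 0) * δ := by
      intro j hj
      obtain ⟨h1, h2⟩ := hU _ _ hj
      refine (h1.card_filter_lt hδ hδ₂ h2 (hCP _) (hCP _) ?_ (hP _)).le
      refine le_trans ?_ (hαC j.succ)
      rw [mul_comm]
      gcongr
    have hgood : α / 2 * #(P 0) ≤ #good := by
      have hsub : C 0 ⊆ good ∪ ({j : Fin m | F.Adj 0 j.succ} : Finset (Fin m)).biUnion bad := by
        intro x hx
        by_cases hg : x ∈ good
        · exact mem_union_left _ hg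
        · refine mem_union_right _ ?_
          simp only [good, mem_filter, hx, true_and, not_forall, not_not] at hg
          obtain ⟨j, hj, hb⟩ := hg
          exact mem_biUnion.2 ⟨j, by simpa using hj, hb⟩
      have h1 : (#(C 0) : ℝ) ≤ #good + m * (#(P 0) * δ) := by
        have h2 : (#(C 0) : ℝ) ≤ #good + ∑ j ∈ ({j : Fin m | F.Adj 0 j.succ} : Finset (Fin m)),
            (#(bad j) : ℝ) := by
          exact_mod_cast (card_le_card hsub).trans ((card_union_le _ _).trans
            (Nat.add_le_add_left card_biUnion_le _))
        refine h2.trans ?_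
        gcongr
        refine (sum_le_card_nsmul _ _ (#(P 0) * δ) fun j hj => hbad j (by simpa using hj)).trans ?_
        rw [nsmul_eq_mul]
        gcongr
        exact (card_le_univ _).trans (by simp)
      have h3 : m * (#(P 0) * δ) ≤ α / 2 * #(P 0) := by
        have : (m : ℝ) * δ ≤ α / 2 := by
          rw [le_div_iff₀ (by positivity)] at hδ₄
          nlinarith
        nlinarith [(Nat.cast_nonneg #(P 0) : (0 : ℝ) ≤ #(P 0))]
      have := hαC 0
      linarith
    -- Once vertex 0 is embedded at x, candidates for its neighbours shrink to the neighbourhood of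
    -- x; for good x a d/2 fraction survives.
    let C' : V → Fin m → Finset V := fun x j =>
      if F.Adj 0 j.succ then {y ∈ C j.succ | G.Adj x y} else C j.succ
    have hC'C : ∀ x j, C' x j ⊆ C j.succ := by
      intro x j
      simp only [C']
      split_ifs
      · exact filter_subset _ _
      · exact Subset.rfl
    let S : V → Finset (Fin m → V) := fun x =>
      {f | (∀ i, f i ∈ C' x i) ∧ ∀ i j, (F.comap Fin.succ).Adj i j → G.Adj (f i) (f j)}
    have hS : ∀ x ∈ good, β₁ * ∏ i : Fin m, (#(P i.succ) : ℝ) ≤ #(S x) := by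
      intro x hx
      refine H δ hδ hδ₁ V G (F.comap Fin.succ) (fun i => P i.succ) (C' x) (fun i => hP _)
        (fun i => (hC'C x i).trans (hCP _)) (fun i => ?_) (fun i j hij => hU _ _ hij)
      have hα' := hαC i.succ
      have hp : (0 : ℝ) ≤ #(P i.succ) := Nat.cast_nonneg _
      by_cases hadj : F.Adj 0 i.succ
      · have hb := (mem_filter.1 hx).2 i hadj
        have hxC := (mem_filter.1 hx).1
        simp only [bad, mem_filter, hxC, true_and, not_lt] at hb
        simp only [C', if_pos hadj]
        refine le_trans ?_ hb
        calc _ ≤ (d / 2 * α) * #(P i.succ) := by gcongr; exact min_le_right _ _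
          _ = d / 2 * (α * #(P i.succ)) := by ring
          _ ≤ _ := by gcongr
      · simp only [C', if_neg hadj]
        exact le_trans (by gcongr; exact min_le_left _ _) hα'
    have hinj : #(good.sigma S) ≤
        #{f : Fin (m + 1) → V | (∀ i, f i ∈ C i) ∧ ∀ i j, F.Adj i j → G.Adj (f i) (f j)} := by
      refine card_le_card_of_injOn (fun p => (Fin.cons p.1 p.2 : Fin (m + 1) → V)) ?_ ?_
      · rintro ⟨x, f⟩ hp
        simp only [mem_coe, mem_sigma] at hp
        obtain ⟨hx, hf⟩ := hp
        obtain ⟨hf1, hf2⟩ := (mem_filter.1 hf).2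
        have h0 : ∀ j : Fin m, F.Adj 0 j.succ → G.Adj x (f j) := by
          intro j hj
          have := hf1 j
          simp only [C', if_pos hj] at this
          exact (mem_filter.1 this).2
        simp only [coe_filter, mem_univ, true_and, Set.mem_ofPred_eq]
        refine ⟨fun i => ?_, fun i j hij => ?_⟩
        · refine Fin.cases ?_ (fun i => ?_) i
          · exact (mem_filter.1 hx).1
          · exact hC'C x i (hf1 i)
        · induction i using Fin.cases with
          | zero =>
            induction j using Fin.cases with
            | zero => exact absurd hij (F.loopless.irrefl _)
            | succ j => exact h0 j hij
          | succ i =>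
            induction j using Fin.cases with
            | zero => exact (h0 i hij.symm).symm
            | succ j => exact hf2 i j hij
      · rintro ⟨x, f⟩ _ ⟨y, g⟩ _ h
        obtain ⟨rfl, rfl⟩ := Fin.cons_injective2 h
        rfl
    rw [Fin.prod_univ_succ]
    calc α / 2 * β₁ * (#(P 0) * ∏ i : Fin m, (#(P i.succ) : ℝ))
        = (α / 2 * #(P 0)) * (β₁ * ∏ i : Fin m, (#(P i.succ) : ℝ)) := by ring
      _ ≤ #good * (β₁ * ∏ i : Fin m, (#(P i.succ) : ℝ)) := by gcongr
      _ ≤ ∑ x ∈ good, (#(S x) : ℝ) := by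
          rw [← nsmul_eq_mul]; exact card_nsmul_le_sum _ _ _ hS
      _ ≤ _ := by
          rw [card_sigma] at hinj
          exact_mod_cast hinj

/-- Parts of an equipartition with at most `M` parts have linear size. -/
theorem Finpartition.IsEquipartition.le_card_part {V : Type*} [Fintype V] [DecidableEq V]
    {P : Finpartition (univ : Finset V)} (hP : P.IsEquipartition) {M : ℕ} (hM : #P.parts ≤ M)
    {s : Finset V} (hs : s ∈ P.parts) : (Fintype.card V : ℝ) / (2 * M) ≤ #s := by
  have hpos : 0 < #P.parts := card_pos.2 ⟨s, hs⟩
  have hle : #P.parts ≤ Fintype.card V := P.card_parts_le_card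
  have h1 : Fintype.card V / #P.parts ≤ #s := by
    simpa using hP.average_le_card_part hs
  have h2 : Fintype.card V < #P.parts * (Fintype.card V / #P.parts + 1) := by
    rw [mul_add, mul_one]
    have := Nat.div_add_mod (Fintype.card V) #P.parts
    have := Nat.mod_lt (Fintype.card V) hpos
    omega
  have h3 : 1 ≤ Fintype.card V / #P.parts := (Nat.one_le_div_iff hpos).2 hle
  -- With p parts and q = ⌊|V|/p⌋ ≥ 1, one has |V| < p(q + 1) ≤ 2pq.
  have h4 : Fintype.card V ≤ M * (2 * #s) :=
    h2.le.trans (Nat.mul_le_mul hM (by omega))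
  have hMpos : (0 : ℝ) < M := by exact_mod_cast hpos.trans_le hM
  rw [div_le_iff₀ (by positivity)]
  have : (Fintype.card V : ℝ) ≤ M * (2 * #s) := by exact_mod_cast h4
  linarith

/-- **Graph removal lemma**: deleting few edges of `G` leaves a graph whose every homomorphic image
of `F` certifies that `G` receives many homomorphisms from `F`. -/
theorem SimpleGraph.exists_removal {U : Type*} [Fintype U] [DecidableEq U] (F : SimpleGraph U)
    (η : ℝ) (hη : 0 < η) :
    ∃ β > 0, ∃ N : ℕ, ∀ (V : Type) [Fintype V] [DecidableEq V] (G : SimpleGraph V)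
      [DecidableRel G.Adj], N ≤ Fintype.card V → Nonempty V →
      ∃ D : Finset (V × V), (#D : ℝ) ≤ η * (Fintype.card V : ℝ) ^ 2 ∧
        ∀ f : U → V, (∀ a b, F.Adj a b → G.Adj (f a) (f b) ∧ (f a, f b) ∉ D) →
          ∃ S : Finset (U → V), (∀ g ∈ S, ∀ a b, F.Adj a b → G.Adj (g a) (g b)) ∧
            β * (Fintype.card V : ℝ) ^ Fintype.card U ≤ #S := by
  classical
  obtain ⟨ε₀, hε₀, β, hβ, hcount⟩ :=
    exists_le_card_homs (Fintype.card U) (η / 16) (by positivity) 1 one_pos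
  set ε := min ε₀ (η / 16) with hεdef
  have hε : 0 < ε := by positivity
  set l : ℕ := ⌈4 / (η / 2)⌉₊
  set M := SzemerediRegularity.bound ε l
  have hM : 0 < M := SzemerediRegularity.bound_pos ..
  refine ⟨β * (1 / (2 * M)) ^ Fintype.card U, by positivity, l, ?_⟩
  intro V _ _ G _ hl _
  obtain ⟨P, hPe, hPl, hPM, hPu⟩ := szemeredi_regularity G hε hl
  -- A homomorphism avoiding these pairs sends edges of F only across dense regular pairs of
  -- distinct parts, so the counting lemma applies to the parts it meets. Non-adjacent vertices may
  -- share a part.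
  refine ⟨(P.nonUniforms G ε).biUnion (fun (X, Y) ↦ X ×ˢ Y) ∪ P.parts.biUnion offDiag ∪
        (P.sparsePairs G (η / 16)).biUnion fun (X, Y) ↦ G.interedges X Y, ?_, ?_⟩
  · have h1 := hPe.sum_nonUniforms_lt univ_nonempty hε hPu
    have h2 := hPe.card_biUnion_offDiag_le (ε := η / 2) (by positivity)
      ((Nat.le_ceil _).trans (by exact_mod_cast hPl))
    have h3 := hPe.card_interedges_sparsePairs_le (G := G) (ε := η / 16) (by positivity)
    have h4 : ε ≤ η / 16 := min_le_right _ _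
    rw [card_univ] at h1 h2 h3
    have h5 : 4 * ε * (Fintype.card V : ℝ) ^ 2 ≤ 4 * (η / 16) * (Fintype.card V : ℝ) ^ 2 := by
      gcongr
    calc _ ≤ (#((P.nonUniforms G ε).biUnion (fun (X, Y) ↦ X ×ˢ Y)) : ℝ) +
          #(P.parts.biUnion offDiag) +
          #((P.sparsePairs G (η / 16)).biUnion fun (X, Y) ↦ G.interedges X Y) := by
            exact_mod_cast (card_union_le _ _).trans (Nat.add_le_add_right (card_union_le _ _) _)
      _ ≤ _ := by
        have : 0 ≤ η * (Fintype.card V : ℝ) ^ 2 := by positivity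
        linarith
  · intro f hf
    let e := Fintype.equivFin U
    choose Q hQ hfQ using fun u => P.exists_mem (mem_univ (f u))
    have hQcard : ∀ u, (Fintype.card V : ℝ) / (2 * M) ≤ #(Q u) := fun u =>
      hPe.le_card_part hPM (hQ u)
    have key := hcount ε hε (min_le_left _ _) V G (F.comap e.symm) (fun i => Q (e.symm i))
      (fun i => Q (e.symm i)) (fun i => ⟨_, hfQ _⟩) (fun i => Subset.rfl) (fun i => by simp) ?_
    · refine ⟨univ.filter fun g : U → V => ∀ a b, F.Adj a b → G.Adj (g a) (g b),
        fun g hg => (mem_filter.1 hg).2, ?_⟩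
      have hle : #{g : Fin (Fintype.card U) → V | (∀ i, g i ∈ Q (e.symm i)) ∧
          ∀ i j, (F.comap e.symm).Adj i j → G.Adj (g i) (g j)} ≤
          #{g : U → V | ∀ a b, F.Adj a b → G.Adj (g a) (g b)} := by
        refine card_le_card_of_injOn (fun g => g ∘ e) ?_ ?_
        · intro g hg
          simp only [coe_filter, mem_univ, true_and, Set.mem_ofPred_eq] at hg ⊢
          intro a b hab
          exact hg.2 (e a) (e b) (by simpa using hab)
        · intro g _ g' _ h
          exact e.surjective.injective_comp_right h
      refine le_trans ?_ (key.trans (by exact_mod_cast hle))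
      rw [mul_assoc]
      gcongr
      rw [← mul_pow]
      calc _ = ∏ _i : Fin (Fintype.card U), (1 / (2 * M) * Fintype.card V : ℝ) := by simp
        _ ≤ _ := by
          refine prod_le_prod (fun i _ => by positivity) fun i _ => ?_
          rw [one_div_mul_eq_div]
          exact hQcard _
    · intro i j hij
      obtain ⟨hG, hD⟩ := hf _ _ hij
      simp only [mem_union, mem_biUnion, not_or, not_exists, not_and, Prod.exists,
        mem_product, mem_offDiag, Finpartition.mk_mem_nonUniforms, Finpartition.mk_mem_sparsePairs,
        SimpleGraph.mem_interedges_iff] at hD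
      obtain ⟨⟨hD1, hD2⟩, hD3⟩ := hD
      have hne : Q (e.symm i) ≠ Q (e.symm j) := fun h =>
        hD2 _ (hQ _) (hfQ (e.symm i)) (h ▸ hfQ (e.symm j)) hG.ne
      constructor
      · by_contra hun
        exact hD1 _ _ ⟨hQ _, hQ _, hne, hun⟩ (hfQ _) (hfQ _)
      · by_contra hlt
        exact hD3 _ _ ⟨hQ _, hQ _, hne, not_le.1 hlt⟩ (hfQ _) (hfQ _) hG

/-- If a large family of functions is given, and for every index few values are forbidden in terms
of the values at the other indices, then some function in the family avoids all of them. -/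
theorem exists_forall_notMem_of_card_lt {U V : Type*} [Fintype U] [DecidableEq U] [Fintype V]
    [DecidableEq V] (T : U → (U → V) → Finset V) (c : ℕ) (hT : ∀ u f, #(T u f) ≤ c)
    (hupd : ∀ u f x, T u (Function.update f u x) = T u f) (S : Finset (U → V))
    (hS : Fintype.card U * c * Fintype.card V ^ Fintype.card U < Fintype.card V * #S) :
    ∃ f ∈ S, ∀ u, f u ∉ T u f := by
  by_contra! hcon
  have hbad : ∀ u, Fintype.card V * #{f : U → V | f u ∈ T u f} ≤
      c * Fintype.card V ^ Fintype.card U := by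
    intro u
    calc Fintype.card V * #{f : U → V | f u ∈ T u f}
        = #(({f : U → V | f u ∈ T u f} : Finset (U → V)) ×ˢ (univ : Finset V)) := by
          rw [card_product, card_univ, mul_comm]
      _ ≤ #((univ : Finset (U → V)).sigma (T u)) := by
          -- Exchanging x with the value at u is reversible, and `T u` does not see the exchange.
          refine card_le_card_of_injOn (fun p => ⟨Function.update p.1 u p.2, p.1 u⟩) ?_ ?_
          · rintro ⟨f, x⟩ hf
            simp only [mem_coe, mem_product, mem_filter, mem_univ, true_and, and_true] at hf
            simp [hupd, hf]
          · rintro ⟨f, x⟩ _ ⟨g, y⟩ _ h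
            simp only [Sigma.mk.injEq, heq_eq_eq] at h
            obtain ⟨h1, h2⟩ := h
            have hxy : x = y := by simpa using congrFun h1 u
            have hfg : f = g := by
              funext w
              by_cases hw : w = u
              · rw [hw, h2]
              · simpa [hw] using congrFun h1 w
            rw [hxy, hfg]
      _ ≤ c * Fintype.card V ^ Fintype.card U := by
          rw [card_sigma]
          refine (sum_le_card_nsmul _ _ c fun f _ => hT u f).trans ?_
          simp [mul_comm]
  have hsub : S ⊆ univ.biUnion fun u => ({f : U → V | f u ∈ T u f} : Finset (U → V)) := by
    intro f hf
    obtain ⟨u, hu⟩ := hcon f hf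
    exact mem_biUnion.2 ⟨u, mem_univ _, by simpa using hu⟩
  have h1 : Fintype.card V * #S ≤ ∑ _u : U, c * Fintype.card V ^ Fintype.card U := by
    refine (Nat.mul_le_mul_left _ ((card_le_card hsub).trans card_biUnion_le)).trans ?_
    rw [mul_sum]
    exact sum_le_sum fun u _ => hbad u
  rw [sum_const, card_univ, smul_eq_mul, ← mul_assoc] at h1
  omega

end Counting

/-! ### Heavy and light pairs, and Berge copies built from them. -/

section Berge

open Finset
open scoped Classical

variable {U V : Type*} [Fintype V]

/-- The hyperedges of `H` containing all vertices of the set `s`. -/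
noncomputable def Hypergraph.edgesContaining (H : Hypergraph V) (s : Set V) : Finset (Set V) :=
  {h | h ∈ H.edgeSet ∧ s ⊆ h}

theorem Hypergraph.mem_edgesContaining {H : Hypergraph V} {s h : Set V} :
    h ∈ H.edgesContaining s ↔ h ∈ H.edgeSet ∧ s ⊆ h := by
  simp [Hypergraph.edgesContaining]

/-- The pairs of vertices lying in at least one and in fewer than `k` hyperedges. -/
def Hypergraph.lightGraph (H : Hypergraph V) (k : ℕ) : SimpleGraph V where
  Adj x y := x ≠ y ∧ (H.edgesContaining {x, y}).Nonempty ∧ #(H.edgesContaining {x, y}) < k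
  symm.symm x y := by
    rintro ⟨h1, h2, h3⟩
    rw [Set.pair_comm] at h2 h3
    exact ⟨h1.symm, h2, h3⟩
  loopless.irrefl x h := h.1 rfl

theorem Hypergraph.containsBerge_of_injective {H : Hypergraph V} (hV : H.vertexSet = Set.univ)
    {F : SimpleGraph U} (ψ : U → V) (hψ : ψ.Injective) (φ : F.edgeSet → Set V)
    (hφ : φ.Injective) (hmem : ∀ e : F.edgeSet, φ e ∈ H.edgesContaining (ψ '' {u | u ∈ (e : Sym2 U)})) :
    H.ContainsBerge F := by
  refine ⟨⟨fun u => ⟨ψ u, hV ▸ Set.mem_univ _⟩, fun a b h => hψ (congrArg Subtype.val h)⟩,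
    ⟨fun e => ⟨φ e, (mem_edgesContaining.1 (hmem e)).1⟩, fun a b h =>
      hφ (congrArg Subtype.val h)⟩, fun e u hu => ?_⟩
  exact (mem_edgesContaining.1 (hmem e)).2 ⟨u, hu, rfl⟩

/-- A copy of `F` all of whose edges but one are heavy extends to a Berge copy of `F`. -/
theorem Hypergraph.containsBerge_of_heavy [Finite U] {H : Hypergraph V}
    (hV : H.vertexSet = Set.univ) {F : SimpleGraph U} {e : Sym2 U} (ψ : U → V) (hψ : ψ.Injective)
    {h : Set V} (hh : h ∈ H.edgeSet) (hψh : ∀ u, ψ u ∈ h)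
    (hheavy : ∀ f ∈ F.edgeSet, f ≠ e →
      F.edgeSet.ncard ≤ #(H.edgesContaining (ψ '' {u | u ∈ f}))) : H.ContainsBerge F := by
  let t : F.edgeSet → Finset (Set V) := fun f => H.edgesContaining (ψ '' {u | u ∈ (f : Sym2 U)})
  -- Hall's condition: one heavy edge in s already offers as many hyperedges as F has edges;
  -- otherwise s has at most the element e, served by h.
  have hall : ∀ s : Finset F.edgeSet, #s ≤ #(s.biUnion t) := by
    intro s
    by_cases hs : ∃ f ∈ s, (f : Sym2 U) ≠ e
    · obtain ⟨f, hf, hne⟩ := hs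
      have h1 : #s ≤ F.edgeSet.ncard := by
        have := Fintype.ofFinite F.edgeSet
        rw [← Nat.card_coe_set_eq, Nat.card_eq_fintype_card]
        exact card_le_univ s
      exact h1.trans ((hheavy f f.2 hne).trans (card_le_card (subset_biUnion_of_mem t hf)))
    · push Not at hs
      have h1 : #s ≤ 1 := card_le_one.2 fun a ha b hb =>
        Subtype.ext ((hs a ha).trans (hs b hb).symm)
      rcases s.eq_empty_or_nonempty with rfl | ⟨f, hf⟩
      · simp
      · refine h1.trans (card_pos.2 ⟨h, mem_biUnion.2 ⟨f, hf, mem_edgesContaining.2 ⟨hh, ?_⟩⟩⟩)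
        rintro _ ⟨u, -, rfl⟩
        exact hψh u
  obtain ⟨φ, hφ, hφt⟩ := (all_card_le_biUnion_card_iff_exists_injective t).1 hall
  exact containsBerge_of_injective hV ψ hψ φ hφ hφt

theorem SimpleGraph.exists_adj_of_mem_edgeSet {F : SimpleGraph U} {f : Sym2 U}
    (hf : f ∈ F.edgeSet) : ∃ a b, F.Adj a b ∧ f = s(a, b) := by
  induction f using Sym2.ind with
  | _ a b => exact ⟨a, b, hf, rfl⟩

theorem image_mem_sym2 {U V : Type*} (ψ : U → V) (a b : U) : ψ '' {u | u ∈ s(a, b)} = {ψ a, ψ b} := by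
  ext x
  simp [eq_comm]

/-- The vertices that may not be the image of `u` when a copy of a graph in the `k`-light graph is
to extend to a Berge copy and all other vertices are mapped by `f`. -/
noncomputable def Hypergraph.forbidden [Fintype U] (H : Hypergraph V) (k : ℕ) (u : U)
    (f : U → V) : Finset V :=
  (univ.erase u).image f ∪
    (((univ.erase u) ×ˢ (univ.erase u)).filter fun p => (H.lightGraph k).Adj (f p.1) (f p.2)).biUnion
      fun p => (H.edgesContaining {f p.1, f p.2}).biUnion fun h => h.toFinset

theorem Hypergraph.forbidden_update [Fintype U] (H : Hypergraph V) (k : ℕ) (u : U) (f : U → V)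
    (x : V) : H.forbidden k u (Function.update f u x) = H.forbidden k u f := by
  have hupd : ∀ a ∈ univ.erase u, Function.update f u x a = f a := fun a ha =>
    Function.update_of_ne (ne_of_mem_erase ha) _ _
  unfold forbidden
  congr 1
  · exact image_congr fun a ha => hupd a ha
  · have hfil : (((univ.erase u) ×ˢ (univ.erase u)).filter fun p : U × U =>
        (H.lightGraph k).Adj (Function.update f u x p.1) (Function.update f u x p.2)) =
        ((univ.erase u) ×ˢ (univ.erase u)).filter fun p => (H.lightGraph k).Adj (f p.1) (f p.2) := by
      refine filter_congr fun p hp => ?_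
      rw [mem_product] at hp
      rw [hupd _ hp.1, hupd _ hp.2]
    rw [hfil]
    refine biUnion_congr rfl fun p hp => ?_
    have hp := mem_product.1 (mem_filter.1 hp).1
    rw [hupd _ hp.1, hupd _ hp.2]

theorem Hypergraph.card_forbidden_le [Fintype U] {H : Hypergraph V} {r : ℕ} (hr : H.IsUniform r)
    (k : ℕ) (u : U) (f : U → V) :
    #(H.forbidden k u f) ≤ Fintype.card U + Fintype.card U * Fintype.card U * (k * r) := by
  refine (card_union_le _ _).trans (Nat.add_le_add ?_ ?_)
  · exact card_image_le.trans (card_le_univ _)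
  · refine (card_biUnion_le_card_mul _ _ (k * r) fun p hp => ?_).trans ?_
    · refine (card_biUnion_le_card_mul _ _ r fun h hh => ?_).trans ?_
      · have := hr h (mem_edgesContaining.1 hh).1
        rw [Set.encard_eq_coe_toFinset_card] at this
        exact_mod_cast this.le
      · exact Nat.mul_le_mul_right _ (mem_filter.1 hp).2.2.2.le
    · refine Nat.mul_le_mul_right _ ((card_filter_le _ _).trans ?_)
      rw [card_product]
      exact Nat.mul_le_mul (card_le_univ _) (card_le_univ _)

/-- A homomorphism to the light graph avoiding all forbidden vertices gives a Berge copy. -/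
theorem Hypergraph.containsBerge_of_notMem_forbidden [Fintype U] {H : Hypergraph V}
    (hV : H.vertexSet = Set.univ) {F : SimpleGraph U} {k : ℕ} (f : U → V)
    (hf : ∀ a b, F.Adj a b → (H.lightGraph k).Adj (f a) (f b))
    (havoid : ∀ u, f u ∉ H.forbidden k u f) : H.ContainsBerge F := by
  have hinj : f.Injective := by
    intro a b hab
    by_contra hne
    exact havoid a (mem_union_left _ (mem_image.2 ⟨b, by simpa using Ne.symm hne, hab.symm⟩))
  have hex : ∀ e : F.edgeSet, ∃ h, h ∈ H.edgesContaining (f '' {u | u ∈ (e : Sym2 U)}) := by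
    rintro ⟨e, he⟩
    obtain ⟨a, b, hab, rfl⟩ := SimpleGraph.exists_adj_of_mem_edgeSet he
    rw [image_mem_sym2]
    exact (hf a b hab).2.1
  choose φ hφ using hex
  refine containsBerge_of_injective hV f hinj φ ?_ hφ
  intro e₁ e₂ h12
  by_contra hne
  -- If e₁ and e₂ shared a hyperedge, an endpoint of e₂ outside e₁ would land in a hyperedge through
  -- the light image of e₁, which is forbidden.
  have hex : ∃ u ∈ (e₂ : Sym2 U), u ∉ (e₁ : Sym2 U) := by
    by_contra! hsub
    obtain ⟨a, b, hab, h2⟩ := SimpleGraph.exists_adj_of_mem_edgeSet e₂.2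
    refine hne (Subtype.ext ?_)
    rw [h2] at hsub ⊢
    exact (Sym2.mem_and_mem_iff hab.ne).1
      ⟨hsub a (Sym2.mem_mk_left _ _), hsub b (Sym2.mem_mk_right _ _)⟩
  obtain ⟨u, hu2, hu1⟩ := hex
  obtain ⟨a, b, hab, h1⟩ := SimpleGraph.exists_adj_of_mem_edgeSet e₁.2
  rw [h1, Sym2.mem_iff, not_or] at hu1
  have hφ1 := hφ e₁
  rw [h1, image_mem_sym2] at hφ1
  refine havoid u (mem_union_right _ (mem_biUnion.2 ⟨(a, b), mem_filter.2 ⟨?_, hf a b hab⟩,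
    mem_biUnion.2 ⟨φ e₁, hφ1, ?_⟩⟩))
  · simp [Ne.symm hu1.1, Ne.symm hu1.2]
  · rw [Set.mem_toFinset, h12]
    exact (mem_edgesContaining.1 (hφ e₂)).2 ⟨u, hu2, rfl⟩

/-- In a Berge-`F`-free hypergraph, every sufficiently large hyperedge contains a light copy of
`F`. -/
theorem Hypergraph.exists_light_copy [Finite U] {H : Hypergraph V} (hV : H.vertexSet = Set.univ)
    {r : ℕ} (hr : H.IsUniform r) {F : SimpleGraph U} {e : Sym2 U}
    (hr' : ramseyNumber F (F.deleteEdges {e}) ≤ r) (hfree : ¬ H.ContainsBerge F)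
    {h : Set V} (hh : h ∈ H.edgeSet) :
    ∃ f : U → V, (∀ u, f u ∈ h) ∧
      ∀ a b, F.Adj a b → (H.lightGraph F.edgeSet.ncard).Adj (f a) (f b) := by
  set R := ramseyNumber F (F.deleteEdges {e})
  have hcard : R ≤ #h.toFinset := by
    have := hr h hh
    rw [Set.encard_eq_coe_toFinset_card] at this
    have : #h.toFinset = r := by exact_mod_cast this
    omega
  obtain ⟨ι, hι, hιh⟩ : ∃ ι : Fin R → V, ι.Injective ∧ ∀ i, ι i ∈ h := by
    let g := (Fin.castLEEmb hcard).trans h.toFinset.equivFin.symm.toEmbedding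
    exact ⟨fun i => g i, fun a b hab => g.injective (Subtype.ext hab), fun i =>
      Set.mem_toFinset.1 (g i).2⟩
  rcases ramseyNumber_spec F (F.deleteEdges {e})
    ((H.lightGraph F.edgeSet.ncard).comap ι) with ⟨⟨c⟩⟩ | ⟨⟨c⟩⟩
  · exact ⟨fun u => ι (c u), fun u => hιh _, fun a b hab => c.toHom.map_adj hab⟩
  · refine absurd (containsBerge_of_heavy (e := e) hV (fun u => ι (c u))
      (hι.comp c.injective) hh (fun u => hιh _) fun f hf hfe => ?_) hfree
    obtain ⟨a, b, hab, rfl⟩ := SimpleGraph.exists_adj_of_mem_edgeSet hf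
    have hadj := c.toHom.map_adj (v := a) (w := b) (by simp [SimpleGraph.deleteEdges_adj, hab, hfe])
    rw [image_mem_sym2 (fun u => ι (c u))]
    by_contra! hlt
    -- The pair lies in h, so it can fail to be light only by being heavy.
    refine hadj.2 ⟨fun heq => hadj.1 (hι heq), ⟨h, mem_edgesContaining.2 ⟨hh, ?_⟩⟩, hlt⟩
    rintro _ (rfl | rfl) <;> exact hιh _

end Berge

/-! ### The o(n²) bound and the threshold. -/

section Main

open Finset
open scoped Classical

theorem Hypergraph.ncard_edgeSet_le_of_not_containsBerge {U : Type*} [Finite U]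
    (F : SimpleGraph U) (hF : F.edgeSet.ncard ≠ 0) (e : Sym2 U) (r : ℕ)
    (hr : ramseyNumber F (F.deleteEdges {e}) ≤ r) (ε : ℝ) (hε : 0 < ε) :
    ∃ N : ℕ, ∀ n ≥ N, ∀ H : Hypergraph (Fin n), H.vertexSet = Set.univ → H.IsUniform r →
      ¬ H.ContainsBerge F → (H.edgeSet.ncard : ℝ) ≤ ε * (n : ℝ) ^ 2 := by
  have := Fintype.ofFinite U
  set k := F.edgeSet.ncard
  have hk : (0 : ℝ) < k := by exact_mod_cast Nat.pos_of_ne_zero hF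
  obtain ⟨β, hβ, N₀, hN₀⟩ := F.exists_removal (ε / k) (by positivity)
  set c := Fintype.card U + Fintype.card U * Fintype.card U * (k * r)
  -- For n ≥ N₁, the family of βn^|U| homomorphisms outnumbers the at most |U|·c·n^(|U|-1) maps that
  -- hit a forbidden vertex.
  obtain ⟨N₁, hN₁⟩ := exists_nat_gt ((Fintype.card U * c : ℝ) / β)
  refine ⟨max (max N₀ N₁) 1, fun n hn H hV hunif hfree => ?_⟩
  have hn0 : N₀ ≤ n := le_trans (le_trans (le_max_left _ _) (le_max_left _ _)) hn
  have hn1 : N₁ ≤ n := le_trans (le_trans (le_max_right _ _) (le_max_left _ _)) hn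
  have hnpos : 0 < n := le_trans (le_max_right _ _) hn
  obtain ⟨D, hD, hmany⟩ := hN₀ (Fin n) (H.lightGraph k) (by simpa using hn0) ⟨⟨0, hnpos⟩⟩
  rw [Fintype.card_fin] at hD
  have hkill : ∀ f : U → Fin n, (∀ a b, F.Adj a b → (H.lightGraph k).Adj (f a) (f b)) →
      ∃ a b, F.Adj a b ∧ (f a, f b) ∈ D := by
    intro f hf
    by_contra! hno
    obtain ⟨S, hS, hScard⟩ := hmany f fun a b hab => ⟨hf a b hab, hno a b hab⟩
    obtain ⟨g, hgS, hg⟩ := exists_forall_notMem_of_card_lt (fun u f => H.forbidden k u f) c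
      (fun u f => H.card_forbidden_le hunif k u f) (fun u f x => H.forbidden_update k u f x) S (by
        rw [Fintype.card_fin] at hScard ⊢
        have h1 : (Fintype.card U * c : ℝ) < n * β := by
          rw [← div_lt_iff₀ hβ]
          exact hN₁.trans_le (by exact_mod_cast hn1)
        have h2 : (Fintype.card U * c : ℝ) * n ^ Fintype.card U < n * #S :=
          calc (Fintype.card U * c : ℝ) * n ^ Fintype.card U
              < n * β * n ^ Fintype.card U := by gcongr
            _ = n * (β * n ^ Fintype.card U) := by ring
            _ ≤ n * #S := by gcongr
        exact_mod_cast h2)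
    exact hfree (containsBerge_of_notMem_forbidden hV g (hS g hgS) hg)
  have hsub : H.edgeSet.toFinset ⊆ {p ∈ D | (H.lightGraph k).Adj p.1 p.2}.biUnion
      fun p => H.edgesContaining {p.1, p.2} := by
    intro h hh
    rw [Set.mem_toFinset] at hh
    obtain ⟨f, hfh, hf⟩ := exists_light_copy hV hunif hr hfree hh
    obtain ⟨a, b, hab, hDab⟩ := hkill f hf
    refine mem_biUnion.2 ⟨(f a, f b), mem_filter.2 ⟨hDab, hf a b hab⟩,
      mem_edgesContaining.2 ⟨hh, ?_⟩⟩
    rintro _ (rfl | rfl) <;> exact hfh _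
  have hcard : H.edgeSet.ncard ≤ #D * k := by
    rw [Set.ncard_eq_toFinset_card']
    refine (card_le_card hsub).trans ((card_biUnion_le_card_mul _ _ k fun p hp => ?_).trans ?_)
    · exact (mem_filter.1 hp).2.2.2.le
    · exact Nat.mul_le_mul_right _ (card_filter_le _ _)
  calc (H.edgeSet.ncard : ℝ) ≤ #D * k := by exact_mod_cast hcard
    _ ≤ (ε / k * n ^ 2) * k := by gcongr
    _ = ε * n ^ 2 := by field_simp

/-- Needed because the threshold only ranges over r₀ ≥ 2; any copy found in `⊥` or its complement
injects at least two vertices. -/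
theorem two_le_ramseyNumber {U W : Type*} [Finite U] [Finite W] [Nontrivial U] [Nontrivial W]
    (G : SimpleGraph U) (H : SimpleGraph W) : 2 ≤ ramseyNumber G H := by
  rcases ramseyNumber_spec G H ⊥ with ⟨⟨c, hc⟩⟩ | ⟨⟨c, hc⟩⟩
  · have h := Nat.card_le_card_of_injective c hc
    rw [Nat.card_fin] at h
    exact Finite.one_lt_card.trans_le h
  · have h := Nat.card_le_card_of_injective c hc
    rw [Nat.card_fin] at h
    exact Finite.one_lt_card.trans_le h

end Main

theorem theorem2 {U : Type*} [Finite U] (F : SimpleGraph U) (hF : 2 ≤ F.edgeSet.ncard)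
    (e : Sym2 U) (he : e ∈ F.edgeSet) :
    uniformityThreshold F ≤ ramseyNumber F (F.deleteEdges {e}) ∧
      ∀ r ≥ ramseyNumber F (F.deleteEdges {e}), ∀ ε : ℝ, 0 < ε → ∃ N : ℕ, ∀ n ≥ N,
        ∀ H : Hypergraph (Fin n), H.vertexSet = Set.univ → H.IsUniform r →
          ¬ H.ContainsBerge F → (H.edgeSet.ncard : ℝ) ≤ ε * (n : ℝ) ^ 2 := by
  have main := fun r (hr : r ≥ ramseyNumber F (F.deleteEdges {e})) =>
    Hypergraph.ncard_edgeSet_le_of_not_containsBerge F (by omega) e r hr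
  refine ⟨Nat.sInf_le ⟨?_, fun r hr => ?_⟩, main⟩
  · obtain ⟨a, b, hab, -⟩ := SimpleGraph.exists_adj_of_mem_edgeSet he
    have : Nontrivial U := ⟨a, b, hab.ne⟩
    exact two_le_ramseyNumber _ _
  · refine isLittleO_iff.2 fun ε hε => ?_
    obtain ⟨N, hN⟩ := main r hr ε hε
    refine eventually_atTop.2 ⟨N, fun n hn => ?_⟩
    rw [Real.norm_of_nonneg (by positivity), Real.norm_of_nonneg (by positivity)]
    -- The supremum lives in `ℕ`, so the real bound is passed through its floor; `csSup_le'` also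
    -- covers an empty set.
    refine (Nat.le_floor_iff (by positivity)).1 (csSup_le' ?_)
    rintro _ ⟨H, hV, hunif, hfree, rfl⟩
    exact Nat.le_floor (hN n hn H hV hunif hfree)
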